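/- Let $K$ be a connected compact Lie group with semisimple Lie algebra $\mathfrak k$, let $\mathfrak t\subset\mathfrak k$ be a Cartan subalgebra, and let $V$ be a finite-dimensional unitary representation of $K$, with infinitesimal action $\mathfrak k\to\mathrm{End}(V)$. Let $(\cdot|\cdot)$ be the invariant inner product on $\mathfrak k$ given by minus the Killing form, denote the induced inner products on $\mathfrak k^*$ and $\mathfrak t^*$ in the same way, and view $\mathfrak t^*\subset\mathfrak k^*$ by extending functionals by zero to $\mathfrak t^\perp$. For $\nu\in\mathfrak t^*$ let $V^\nu=\{v\in V: hv=i\nu(h)v \text{ for all } h\in\mathfrak t\}$, let $\Lambda(V)=\{\nu\in\mathfrak t^*: V^\nu\neq0\}$ be the set of weights, and let $\Delta\subset\mathfrak t^*\setminus\{0\}$ be the set of roots, i.e. the nonzero weights of $\mathfrak t$ on $\mathfrak k\otimes\mathbb C$. Let $$\mu:\mathbb P(V)\to\mathfrak k^*,\qquad \mu[v](x)=\frac1i\,\frac{\langle xv,v\rangle}{\langle v,v\rangle}\quad(x\in\mathfrak k)$$ be the momentum map. For $\xi\in\mathfrak t^*$ let $C_\xi$ be the set of critical points of $\|\mu\|^2$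 that lie in $\mu^{-1}(\xi)$; $\xi$ is called an intermediate critical value of $\|\mu\|^2$ if $C_\xi\neq\emptyset$. For a nonempty set $M\subset\Lambda(V)$ let $\xi_M$ be the point of the convex hull of $M$ closest to $0$. Let $\xi=\xi_M$ for some such $M$, and suppose that $\xi$ is regular, i.e. lies in the interior of a Weyl chamber: $(\alpha|\xi)\neq0$ for all $\alpha\in\Delta$. Put $\Lambda_\xi=\{\nu\in\Lambda(V):(\nu|\xi)=\|\xi\|^2\}$. Then: 1. $\xi$ is an intermediate critical value of $\|\mu\|^2$, i.e. $C_\xi\ne\emptyset$. 2. $\Lambda_\xi$ is root-distinct, i.e. $\Lambda_\xi\cap(\Delta+\Lambda_\xi)=\emptyset$. 3. $\Lambda_\xi$ is finite, and there are $a_\lambda\ge0$ ($\lambda\in\Lambda_\xi$) with $\sum_{\lambda\in\Lambda_\xi} a_\lambda=1$ and $\sum_{\lambda\in\Lambda_\xi} a_\lambda\lambda=\xi$. 4. For every such family $(a_\lambda)$ and every choice of unit weight vectors $v^\lambda\in V^\lambda$ ($\lambda\in\Lambda_\xi$), the vector $v=\sum_{\lambda\in\Lambda_\xi}\sqrt{a_\lambda}\,v^\lambda$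 is nonzero, $[v]$ is a critical point of $\|\mu\|^2$, and $\mu[v]=\xi$. -/

import Mathlib

open scoped Manifold ContDiff TensorProduct Pointwise LinearAlgebra.Projectivization

noncomputable section

namespace MomentumMap

section LieAlgebra

variable {𝔨 : Type*} [LieRing 𝔨] [LieAlgebra ℝ 𝔨]

/-- The roots of `(𝔨, 𝔱)`: nonzero functionals `α` on `𝔱` such that the complexification of `𝔨`
has a nonzero root vector, on which each `h ∈ 𝔱` acts by the scalar `i α(h)`.
Here and for weights, the `i`-valued functional `iα` on `𝔱` is recorded by the real functional
`α ∈ 𝔱*`, that is, weights are regarded as elements of `𝔱*`. -/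
def roots (𝔱 : LieSubalgebra ℝ 𝔨) : Set (Module.Dual ℝ 𝔱) :=
  {α | α ≠ 0 ∧ ∃ e : ℂ ⊗[ℝ] 𝔨, e ≠ 0 ∧
    ∀ h : 𝔱, ⁅(1 : ℂ) ⊗ₜ[ℝ] (h : 𝔨), e⁆ = (Complex.I * (α h : ℂ)) • e}

/-- A set of weights is root-distinct if no two of its elements differ by a root. -/
def RootDistinct (𝔱 : LieSubalgebra ℝ 𝔨) (M : Set (Module.Dual ℝ 𝔱)) : Prop :=
  M ∩ (roots 𝔱 + M) = ∅

variable [FiniteDimensional ℝ 𝔨] [LieAlgebra.IsKilling ℝ 𝔨]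

/-- The invariant inner product `(f | g)` on `𝔨*` induced by the Killing form. The Killing form of a
compact semisimple Lie algebra is negative definite on `𝔨`, so it enters with a minus sign. -/
def innerDual (f g : Module.Dual ℝ 𝔨) : ℝ :=
  -f (((killingForm ℝ 𝔨).toDual (LieAlgebra.IsKilling.killingForm_nondegenerate ℝ 𝔨)).symm g)

variable (𝔱 : LieSubalgebra ℝ 𝔨) [𝔱.IsCartanSubalgebra]

/-- The inner product `(μ | ν)` on `𝔱*` induced by (minus) the restriction of the Killing form
to `𝔱`. -/
def innerCartan (μ ν : Module.Dual ℝ 𝔱) : ℝ :=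
  -μ ((LieAlgebra.IsKilling.cartanEquivDual 𝔱).symm ν)

/-- The embedding `𝔱* → 𝔨*` given by the Killing form: first `ξ ∈ 𝔱*` is represented as
`ξ = κ(h, ·)` on `𝔱` with `h ∈ 𝔱`, and then it is sent to `κ(h, ·)` on `𝔨`. Equivalently, `ξ` is
extended by zero to the orthogonal complement of `𝔱`. -/
def cartanDualEmbedding (ξ : Module.Dual ℝ 𝔱) : Module.Dual ℝ 𝔨 :=
  killingForm ℝ 𝔨 ((LieAlgebra.IsKilling.cartanEquivDual 𝔱).symm ξ : 𝔨)

/-- `ξ ∈ 𝔱*` is regular if it lies in the interior of a Weyl chamber, that is, on no root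
hyperplane. -/
def IsRegular (ξ : Module.Dual ℝ 𝔱) : Prop :=
  ∀ α ∈ roots 𝔱, innerCartan 𝔱 α ξ ≠ 0

/-- `ξ` is the point of `C` closest to the origin. -/
def IsClosestToZero (C : Set (Module.Dual ℝ 𝔱)) (ξ : Module.Dual ℝ 𝔱) : Prop :=
  ξ ∈ C ∧ ∀ η ∈ C, innerCartan 𝔱 ξ ξ ≤ innerCartan 𝔱 η η

end LieAlgebra

section Representation

variable {𝔨 : Type*} [LieRing 𝔨] [LieAlgebra ℝ 𝔨]
  {V : Type*} [NormedAddCommGroup V] [InnerProductSpace ℂ V]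

/-- The weight space `V^ν` of the infinitesimal action `φ` of `𝔨` on `V`, for `ν ∈ 𝔱*`. -/
def weightSpace (φ : 𝔨 →ₗ[ℝ] (V →L[ℂ] V)) (𝔱 : LieSubalgebra ℝ 𝔨) (ν : Module.Dual ℝ 𝔱) :
    Submodule ℂ V :=
  ⨅ h : 𝔱, Module.End.eigenspace (φ (h : 𝔨) : V →ₗ[ℂ] V) (Complex.I * (ν h : ℂ))

/-- The set `Λ(V)` of weights of `V`. -/
def weights (φ : 𝔨 →ₗ[ℝ] (V →L[ℂ] V)) (𝔱 : LieSubalgebra ℝ 𝔨) : Set (Module.Dual ℝ 𝔱) :=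
  {ν | weightSpace φ 𝔱 ν ≠ ⊥}

/-- `x ↦ (1/i) ⟨x v, v⟩ / ⟨v, v⟩`, for the Hermitian form linear in its first argument (Mathlib's
`inner ℂ v w` is linear in `w`, so `⟨w, v⟩` is `inner ℂ v w`). The value is real when `𝔨` acts by
skew-Hermitian operators. -/
def momentumVec (φ : 𝔨 →ₗ[ℝ] (V →L[ℂ] V)) (v : V) : Module.Dual ℝ 𝔨 where
  toFun x := ((1 / Complex.I) * (inner ℂ v (φ x v) / inner ℂ v v)).re
  map_add' x y := by
    simp only [map_add, add_apply, inner_add_right, add_div, mul_add,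
      Complex.add_re]
  map_smul' c x := by
    have h : inner ℂ v ((φ (c • x)) v) = (c : ℂ) * inner ℂ v (φ x v) := by
      rw [map_smul, smul_apply, ← Complex.coe_smul, inner_smul_right]
    rw [h, mul_div_assoc, mul_left_comm, Complex.re_ofReal_mul]
    rfl

lemma momentumVec_smul (φ : 𝔨 →ₗ[ℝ] (V →L[ℂ] V)) {c : ℂ} (hc : c ≠ 0) (v : V) :
    momentumVec φ (c • v) = momentumVec φ v := by
  ext x
  have h : inner ℂ (c • v) (φ x (c • v)) / inner ℂ (c • v) (c • v)
      = inner ℂ v (φ x v) / inner ℂ v v := by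
    rw [map_smul, inner_smul_left, inner_smul_right, inner_smul_left, inner_smul_right,
      ← mul_assoc, ← mul_assoc]
    exact mul_div_mul_left _ _ (mul_ne_zero (by simpa using hc) hc)
  simp only [momentumVec, LinearMap.coe_mk, AddHom.coe_mk, h]

/-- The momentum map `μ : ℙ(V) → 𝔨*`, `μ[v](x) = (1/i) ⟨x v, v⟩ / ⟨v, v⟩`. -/
def momentum (φ : 𝔨 →ₗ[ℝ] (V →L[ℂ] V)) : ℙ ℂ V → Module.Dual ℝ 𝔨 :=
  Projectivization.lift (fun v => momentumVec φ (v : V)) (by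
    rintro ⟨a, ha⟩ ⟨b, hb⟩ t (rfl : a = t • b)
    exact momentumVec_smul φ (fun h => ha (by rw [h, zero_smul])) b)

open Classical in
/-- The pull-back of a function on `ℙ(V)` along `V ∖ {0} → ℙ(V)` (with the irrelevant value `0` at
the origin). -/
def pullback (f : ℙ ℂ V → ℝ) (v : V) : ℝ :=
  if hv : v ≠ 0 then f (Projectivization.mk ℂ v hv) else 0

/-- `p ∈ ℙ(V)` is a critical point of `f : ℙ(V) → ℝ`. As `V ∖ {0} → ℙ(V)` is a surjective
submersion, this says that the pull-back of `f` to `V ∖ {0}` has (real) derivative zero at the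
vectors over `p`. -/
def IsCriticalPoint (f : ℙ ℂ V → ℝ) (p : ℙ ℂ V) : Prop :=
  ∀ (v : V) (hv : v ≠ 0), Projectivization.mk ℂ v hv = p →
    HasFDerivAt (pullback f) (0 : V →L[ℝ] ℝ) v

variable [FiniteDimensional ℝ 𝔨] [LieAlgebra.IsKilling ℝ 𝔨]

/-- The function `‖μ‖²` on `ℙ(V)`. -/
def momentumNormSq (φ : 𝔨 →ₗ[ℝ] (V →L[ℂ] V)) (p : ℙ ℂ V) : ℝ :=
  innerDual (momentum φ p) (momentum φ p)

variable (φ : 𝔨 →ₗ[ℝ] (V →L[ℂ] V)) (𝔱 : LieSubalgebra ℝ 𝔨) [𝔱.IsCartanSubalgebra]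

/-- The set `Ξ` of the points `ξ_M` of `𝔱*`, where `M` is a (nonempty) set of weights of `V` and
`ξ_M` is the point of the convex hull of `M` closest to the origin. -/
def closestPoints : Set (Module.Dual ℝ 𝔱) :=
  {ξ | ∃ M ⊆ weights φ 𝔱, IsClosestToZero 𝔱 (convexHull ℝ M) ξ}

/-- `Λ_ξ = {ν ∈ Λ(V) : (ν | ξ) = ‖ξ‖²}`. -/
def weightsAt (ξ : Module.Dual ℝ 𝔱) : Set (Module.Dual ℝ 𝔱) :=
  {ν ∈ weights φ 𝔱 | innerCartan 𝔱 ν ξ = innerCartan 𝔱 ξ ξ}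

/-- The critical set `C_ξ` of critical points of `‖μ‖²` in `μ⁻¹(ξ)`. -/
def criticalSet (ξ : Module.Dual ℝ 𝔱) : Set (ℙ ℂ V) :=
  {p | momentum φ p = cartanDualEmbedding 𝔱 ξ ∧ IsCriticalPoint (momentumNormSq φ) p}

/-- `ξ` is an intermediate critical value of `‖μ‖²` if `μ⁻¹(ξ)` contains critical points of
`‖μ‖²`. -/
def IsIntermediateCriticalValue (ξ : Module.Dual ℝ 𝔱) : Prop :=
  (criticalSet φ 𝔱 ξ).Nonempty

end Representation

section LieGroup

variable {E : Type*} [NormedAddCommGroup E] [NormedSpace ℝ E]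
  {K : Type*} [TopologicalSpace K] [ChartedSpace E K] [Group K]
  {V : Type*} [NormedAddCommGroup V] [InnerProductSpace ℂ V]

instance instLieGroupMinSmoothness [LieGroup 𝓘(ℝ, E) ∞ K] :
    LieGroup 𝓘(ℝ, E) (minSmoothness ℝ 3) K := by
  rw [minSmoothness_of_isRCLikeNormedField]
  infer_instance

instance instFiniteDimensionalGroupLieAlgebra [FiniteDimensional ℝ E] :
    FiniteDimensional ℝ (GroupLieAlgebra 𝓘(ℝ, E) K) :=
  inferInstanceAs (FiniteDimensional ℝ E)

/-- A unitary representation of `K` on `V`, as a map to the normed space of operators on `V`. -/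
def toOperator (ρ : K →* (V ≃ₗᵢ[ℂ] V)) (g : K) : V →L[ℂ] V :=
  ((ρ g).toContinuousLinearEquiv : V →L[ℂ] V)

/-- The infinitesimal action `dρ : 𝔨 → End(V)` of the Lie algebra `𝔨 = T₁K` on `V`. -/
def infinitesimal (ρ : K →* (V ≃ₗᵢ[ℂ] V)) :
    GroupLieAlgebra 𝓘(ℝ, E) K →ₗ[ℝ] (V →L[ℂ] V) :=
  (mfderiv 𝓘(ℝ, E) 𝓘(ℝ, V →L[ℂ] V) (toOperator ρ) (1 : K)).toLinearMap

end LieGroup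

end MomentumMap

end

namespace MomentumMap

/-! ### Duality through the Killing form, and convexity in `𝔱*`. -/

section LieAlgebra

variable {𝔨 : Type*} [LieRing 𝔨] [LieAlgebra ℝ 𝔨] [FiniteDimensional ℝ 𝔨]
  [LieAlgebra.IsKilling ℝ 𝔨]

/-! Regularity enters once: if `μ` and `α + μ` both lie on the hyperplane `(ν | ξ) = ‖ξ‖²`, then `(α
| ξ) = 0`, so `Λ_ξ` is root-distinct. A nonzero matrix coefficient of `𝔨` between different weight
spaces forces the weights to differ by a root (`IsRepresentation.sub_mem_roots`). Hence for `v = ∑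
√a_λ v^λ` all cross terms of the momentum vanish, and `μ[v] = ∑ a_λ λ`
(`RootDistinct.momentumVec_sum`). The variational inequality for the closest point makes `ξ` such a
convex combination (`IsClosestToZero.mem_convexHull`).

For criticality, let `h ∈ 𝔱` represent `ξ`. All weights in `Λ_ξ` agree on `h`, so `v` is an
eigenvector of `h`, and `μ(·)(h)` is stationary there. Up to a factor this is the linear term of
`‖μ‖²` expanded about `μ[v] = ξ`; the remainder is quadratic in `μ - ξ`
(`hasFDerivAt_pullback_momentumNormSq`). -/

lemma exists_killingForm_eq (f : Module.Dual ℝ 𝔨) : ∃ y : 𝔨, killingForm ℝ 𝔨 y = f :=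
  ⟨_, LinearEquiv.apply_symm_apply
    ((killingForm ℝ 𝔨).toDual (LieAlgebra.IsKilling.killingForm_nondegenerate ℝ 𝔨)) f⟩

lemma killingForm_injective : Function.Injective (killingForm ℝ 𝔨) :=
  ((killingForm ℝ 𝔨).toDual (LieAlgebra.IsKilling.killingForm_nondegenerate ℝ 𝔨)).injective

lemma innerDual_killingForm (f : Module.Dual ℝ 𝔨) (y : 𝔨) :
    innerDual f (killingForm ℝ 𝔨 y) = -f y := by
  have h : ((killingForm ℝ 𝔨).toDual
      (LieAlgebra.IsKilling.killingForm_nondegenerate ℝ 𝔨)).symm (killingForm ℝ 𝔨 y) = y :=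
    LinearEquiv.symm_apply_apply
      ((killingForm ℝ 𝔨).toDual (LieAlgebra.IsKilling.killingForm_nondegenerate ℝ 𝔨)) y
  rw [innerDual, h]

lemma innerDual_comm (f g : Module.Dual ℝ 𝔨) : innerDual f g = innerDual g f := by
  obtain ⟨x, rfl⟩ := exists_killingForm_eq f
  obtain ⟨y, rfl⟩ := exists_killingForm_eq g
  rw [innerDual_killingForm, innerDual_killingForm, LieModule.traceForm_comm]

lemma innerDual_add_left (f g k : Module.Dual ℝ 𝔨) :
    innerDual (f + g) k = innerDual f k + innerDual g k := by
  simp only [innerDual, LinearMap.add_apply]; ring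

lemma innerDual_self_eq (f g : Module.Dual ℝ 𝔨) :
    innerDual f f = innerDual g g + 2 * innerDual (f - g) g + innerDual (f - g) (f - g) := by
  have h₁ : innerDual f f = innerDual (f - g) f + innerDual g f := by
    rw [← innerDual_add_left, sub_add_cancel]
  have h₂ (k : Module.Dual ℝ 𝔨) : innerDual f k = innerDual (f - g) k + innerDual g k := by
    rw [← innerDual_add_left, sub_add_cancel]
  rw [h₁, innerDual_comm (f - g) f, innerDual_comm g f, h₂, h₂, innerDual_comm g (f - g)]
  ring

/-- A nonzero `ℂ`-valued functional `ℓ₁ + i ℓ₂` on `𝔨` with `ℓ(⁅h, x⁆) = i α(h) ℓ(x)` for all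
`h ∈ 𝔱` is represented, through the Killing form, by a root vector of weight `-α`. -/
lemma neg_mem_roots_of_dual (𝔱 : LieSubalgebra ℝ 𝔨) {α : Module.Dual ℝ 𝔱} (hα : α ≠ 0)
    {ℓ₁ ℓ₂ : Module.Dual ℝ 𝔨}
    (h₁ : ∀ (h : 𝔱) (x : 𝔨), ℓ₁ ⁅(h : 𝔨), x⁆ = -α h * ℓ₂ x)
    (h₂ : ∀ (h : 𝔱) (x : 𝔨), ℓ₂ ⁅(h : 𝔨), x⁆ = α h * ℓ₁ x)
    (hℓ : ℓ₁ ≠ 0 ∨ ℓ₂ ≠ 0) : -α ∈ roots 𝔱 := by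
  obtain ⟨e₁, rfl⟩ := exists_killingForm_eq ℓ₁
  obtain ⟨e₂, rfl⟩ := exists_killingForm_eq ℓ₂
  -- Invariance of the Killing form moves the bracket to the other argument at the cost of a sign;
  -- this is why the weight becomes `-α`.
  have k₁ (h : 𝔱) : ⁅(h : 𝔨), e₁⁆ = α h • e₂ := by
    apply killingForm_injective
    ext x
    rw [LieModule.traceForm_apply_lie_apply', h₁]
    simp
  have k₂ (h : 𝔱) : ⁅(h : 𝔨), e₂⁆ = -α h • e₁ := by
    apply killingForm_injective
    ext x
    rw [LieModule.traceForm_apply_lie_apply', h₂]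
    simp
  refine ⟨neg_ne_zero.mpr hα, (1 : ℂ) ⊗ₜ[ℝ] e₁ + Complex.I ⊗ₜ[ℝ] e₂, ?_, fun h => ?_⟩
  · intro he
    have r := congrArg (fun z => TensorProduct.lid ℝ 𝔨 (Complex.reLm.rTensor 𝔨 z)) he
    have i := congrArg (fun z => TensorProduct.lid ℝ 𝔨 (Complex.imLm.rTensor 𝔨 z)) he
    simp at r i
    simp [r, i] at hℓ
  · refine (lie_add ((1 : ℂ) ⊗ₜ[ℝ] (h : 𝔨)) ((1 : ℂ) ⊗ₜ[ℝ] e₁) (Complex.I ⊗ₜ[ℝ] e₂)).trans ?_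
    rw [LieAlgebra.ExtendScalars.bracket_tmul, LieAlgebra.ExtendScalars.bracket_tmul, k₁, k₂,
      smul_add, TensorProduct.smul_tmul', TensorProduct.smul_tmul',
      ← TensorProduct.smul_tmul, ← TensorProduct.smul_tmul, add_comm]
    congr 2
    · apply Complex.ext <;> simp
    · apply Complex.ext <;> simp

variable (𝔱 : LieSubalgebra ℝ 𝔨) [𝔱.IsCartanSubalgebra]

/-- A functional on `𝔨` vanishing on `[𝔱, 𝔨]` lies in `𝔱*`. -/
lemma eq_cartanDualEmbedding {f : Module.Dual ℝ 𝔨} {ξ : Module.Dual ℝ 𝔱}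
    (hf : ∀ (h : 𝔱) (x : 𝔨), f ⁅(h : 𝔨), x⁆ = 0) (hξ : ∀ h : 𝔱, f h = ξ h) :
    f = cartanDualEmbedding 𝔱 ξ := by
  obtain ⟨y, rfl⟩ := exists_killingForm_eq f
  have hy : ∀ h : 𝔱, ⁅(h : 𝔨), y⁆ = 0 := fun h => by
    apply killingForm_injective
    ext x
    rw [LieModule.traceForm_apply_lie_apply', hf]
    simp
  -- The representing vector `y` commutes with `𝔱`, and a Cartan subalgebra is its own normalizer.
  have hy𝔱 : y ∈ 𝔱 := by
    rw [← LieSubalgebra.IsCartanSubalgebra.self_normalizing (H := 𝔱),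
      LieSubalgebra.mem_normalizer_iff']
    intro h hh
    rw [hy ⟨h, hh⟩]
    exact zero_mem _
  have : LieAlgebra.IsKilling.cartanEquivDual 𝔱 ⟨y, hy𝔱⟩ = ξ := by
    ext h
    rw [← hξ]
    rfl
  rw [cartanDualEmbedding, ← this, LinearEquiv.symm_apply_apply]

lemma innerCartan_comm (μ ν : Module.Dual ℝ 𝔱) : innerCartan 𝔱 μ ν = innerCartan 𝔱 ν μ := by
  obtain ⟨x, rfl⟩ := (LieAlgebra.IsKilling.cartanEquivDual 𝔱).surjective μ
  obtain ⟨y, rfl⟩ := (LieAlgebra.IsKilling.cartanEquivDual 𝔱).surjective ν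
  simp only [innerCartan, LinearEquiv.symm_apply_apply]
  exact congrArg Neg.neg (LieModule.traceForm_comm ℝ 𝔱 𝔨 x y)

/-- The form `innerCartan`, as a functional of its first argument. -/
noncomputable def innerCartanLeft (ξ : Module.Dual ℝ 𝔱) : Module.Dual ℝ (Module.Dual ℝ 𝔱) :=
  -Module.Dual.eval ℝ 𝔱 ((LieAlgebra.IsKilling.cartanEquivDual 𝔱).symm ξ)

lemma innerCartanLeft_apply (ξ ν : Module.Dual ℝ 𝔱) :
    innerCartanLeft 𝔱 ξ ν = innerCartan 𝔱 ν ξ := rfl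

/-- The variational inequality for the point of a convex set closest to the origin. -/
lemma IsClosestToZero.le_innerCartan {C : Set (Module.Dual ℝ 𝔱)} {ξ : Module.Dual ℝ 𝔱}
    (h : IsClosestToZero 𝔱 C ξ) (hC : Convex ℝ C) {η : Module.Dual ℝ 𝔱} (hη : η ∈ C) :
    innerCartan 𝔱 ξ ξ ≤ innerCartan 𝔱 η ξ := by
  by_contra! hlt
  set a := innerCartan 𝔱 ξ ξ
  set b := innerCartan 𝔱 η ξ
  set c := innerCartan 𝔱 η η
  -- The right side is the change of the squared norm in moving from `ξ` to `(1 - t) ξ + t η`.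
  have key (t : ℝ) (h0 : 0 ≤ t) (h1 : t ≤ 1) : 0 ≤ t * (2 * (b - a) + t * (a - 2 * b + c)) := by
    have hmem : (1 - t) • ξ + t • η ∈ C :=
      hC h.1 hη (by linarith) h0 (by ring)
    have hle := h.2 _ hmem
    have e (ν : Module.Dual ℝ 𝔱) : innerCartan 𝔱 ((1 - t) • ξ + t • η) ν
        = (1 - t) * innerCartan 𝔱 ξ ν + t * innerCartan 𝔱 η ν := by
      simp only [← innerCartanLeft_apply, map_add, map_smul, smul_eq_mul]
    rw [e, innerCartan_comm 𝔱 ξ (_ + _), innerCartan_comm 𝔱 η (_ + _), e, e,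
      innerCartan_comm 𝔱 ξ η] at hle
    change a ≤ (1 - t) * ((1 - t) * a + t * b) + t * ((1 - t) * b + t * c) at hle
    linarith
  -- Take `t = (a - b) / (2 (a - b) + |a - 2b + c|)`: it lies in `(0, 1]`, and `t (a - 2b + c) ≤ a -
  -- b` makes the second factor in `key` negative.
  have hd : 0 < 2 * (a - b) + |a - 2 * b + c| := by have := abs_nonneg (a - 2 * b + c); linarith
  have ht : 0 < (a - b) / (2 * (a - b) + |a - 2 * b + c|) := div_pos (by linarith) hd
  have ht1 : (a - b) / (2 * (a - b) + |a - 2 * b + c|) ≤ 1 := by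
    rw [div_le_one hd]; have := abs_nonneg (a - 2 * b + c); linarith
  have hk := key _ ht.le ht1
  have hk' := nonneg_of_mul_nonneg_right hk ht
  have : (a - b) / (2 * (a - b) + |a - 2 * b + c|) * (a - 2 * b + c) ≤ a - b := by
    rw [div_mul_eq_mul_div, div_le_iff₀ hd]
    have h3 := le_abs_self (a - 2 * b + c)
    apply mul_le_mul_of_nonneg_left _ (by linarith)
    linarith
  linarith

/-- The point of a convex hull closest to the origin is a convex combination of those points that
lie on the supporting hyperplane through it. -/
lemma IsClosestToZero.mem_convexHull {M : Set (Module.Dual ℝ 𝔱)} {ξ : Module.Dual ℝ 𝔱}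
    (h : IsClosestToZero 𝔱 (convexHull ℝ M) ξ) :
    ξ ∈ convexHull ℝ {ν ∈ M | innerCartan 𝔱 ν ξ = innerCartan 𝔱 ξ ξ} := by
  obtain ⟨ι, _, w, z, hw, hw1, hz, hsum⟩ := mem_convexHull_iff_exists_fintype.1 h.1
  have hle (i : ι) : 0 ≤ w i * (innerCartan 𝔱 (z i) ξ - innerCartan 𝔱 ξ ξ) :=
    mul_nonneg (hw i) (sub_nonneg.2
      (h.le_innerCartan 𝔱 (convex_convexHull ℝ M) (subset_convexHull ℝ M (hz i))))
  -- Pairing the combination with `ξ` shows that the nonnegative excesses average to zero.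
  have hzero : ∑ i, w i * (innerCartan 𝔱 (z i) ξ - innerCartan 𝔱 ξ ξ) = 0 := by
    have : innerCartanLeft 𝔱 ξ (∑ i, w i • z i) = innerCartan 𝔱 ξ ξ := by rw [hsum]; rfl
    simp only [map_sum, map_smul, smul_eq_mul, innerCartanLeft_apply] at this
    simp only [mul_sub, Finset.sum_sub_distrib, ← Finset.sum_mul, hw1, this, one_mul, sub_self]
  have heq := (Finset.sum_eq_zero_iff_of_nonneg fun i _ => hle i).1 hzero
  -- Points of weight zero may lie off the hyperplane, so they are discarded.
  have hc : (Finset.univ.filter (w · ≠ 0)).centerMass w z = ξ := by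
    rw [Finset.centerMass_filter_ne_zero, Finset.centerMass_eq_of_sum_1 _ _ hw1, hsum]
  refine (congrArg (· ∈ convexHull ℝ _) hc).mp <|
    Finset.centerMass_mem_convexHull _ (fun i _ => hw i) ?_ fun i hi => ⟨hz i, ?_⟩
  · rw [Finset.sum_filter_ne_zero, hw1]
    exact one_pos
  · have := (mul_eq_zero.1 (heq i (Finset.mem_univ i))).resolve_left (Finset.mem_filter.1 hi).2
    linarith

end LieAlgebra

end MomentumMap

namespace MomentumMap

/-! ### Differentiating a unitary representation of the group. -/

section LieGroup

variable {E : Type*} [NormedAddCommGroup E] [NormedSpace ℝ E]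

/-- The differential of a map from a manifold modelled on `E` to a normed space, as a map on `E`. -/
noncomputable def differential (E : Type*) [NormedAddCommGroup E] [NormedSpace ℝ E]
    {M : Type*} [TopologicalSpace M] [ChartedSpace E M]
    {A : Type*} [NormedAddCommGroup A] [NormedSpace ℝ A] (F : M → A) (x : M) : E →L[ℝ] A :=
  mfderiv 𝓘(ℝ, E) 𝓘(ℝ, A) F x

lemma hasFDerivAt_differential {M : Type*} [TopologicalSpace M] [ChartedSpace E M]
    {A : Type*} [NormedAddCommGroup A] [NormedSpace ℝ A] {F : M → A} {x : M}
    (hF : MDifferentiableAt 𝓘(ℝ, E) 𝓘(ℝ, A) F x) :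
    HasFDerivAt (F ∘ (extChartAt 𝓘(ℝ, E) x).symm) (differential E F x)
      (extChartAt 𝓘(ℝ, E) x x) := by
  have h : HasFDerivWithinAt (F ∘ (extChartAt 𝓘(ℝ, E) x).symm) (differential E F x)
      (Set.range 𝓘(ℝ, E)) (extChartAt 𝓘(ℝ, E) x x) := hF.hasMFDerivAt.2
  rwa [modelWithCornersSelf_coe, Set.range_id, hasFDerivWithinAt_univ] at h

open VectorField in
/-- The differential of a map into a normed space sends the Lie bracket of two vector fields to
the commutator of the corresponding derivations. -/
lemma differential_mlieBracket {M : Type*} [TopologicalSpace M] [ChartedSpace E M]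
    [CompleteSpace E] [IsManifold 𝓘(ℝ, E) ∞ M] {A : Type*} [NormedAddCommGroup A]
    [NormedSpace ℝ A] {F gX gY : M → A} (hF : ContMDiff 𝓘(ℝ, E) 𝓘(ℝ, A) ∞ F)
    {X Y : Π x : M, TangentSpace 𝓘(ℝ, E) x} {x : M}
    (hX : MDifferentiableAt 𝓘(ℝ, E) 𝓘(ℝ, E).tangent (fun y => (X y : TangentBundle 𝓘(ℝ, E) M)) x)
    (hY : MDifferentiableAt 𝓘(ℝ, E) 𝓘(ℝ, E).tangent (fun y => (Y y : TangentBundle 𝓘(ℝ, E) M)) x)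
    (hgX : ∀ y, differential E F y (X y) = gX y)
    (hgY : ∀ y, differential E F y (Y y) = gY y)
    (hdX : MDifferentiableAt 𝓘(ℝ, E) 𝓘(ℝ, A) gX x)
    (hdY : MDifferentiableAt 𝓘(ℝ, E) 𝓘(ℝ, A) gY x) :
    differential E F x (mlieBracket 𝓘(ℝ, E) X Y x)
      = differential E gY x (X x) - differential E gX x (Y x) := by
  have : IsManifold 𝓘(ℝ, E) 2 M := IsManifold.of_le (n := ∞) (by norm_cast)
  have : IsManifold 𝓘(ℝ, E) 1 M := IsManifold.of_le (n := ∞) (by norm_cast)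
  set ψ := (extChartAt 𝓘(ℝ, E) x).symm
  set e := extChartAt 𝓘(ℝ, E) x x
  have hψe : ψ e = x := extChartAt_to_inv x
  have hnhds : (extChartAt 𝓘(ℝ, E) x).target ∈ nhds e := extChartAt_target_mem_nhds x
  have hψc : ContMDiffAt 𝓘(ℝ, E) 𝓘(ℝ, E) ∞ ψ e :=
    (contMDiffOn_extChartAt_symm x).contMDiffAt hnhds
  have hψd {y : E} (hy : y ∈ (extChartAt 𝓘(ℝ, E) x).target) :
      MDifferentiableAt 𝓘(ℝ, E) 𝓘(ℝ, E) ψ y :=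
    ((contMDiffOn_extChartAt_symm (n := ∞) x).contMDiffAt
      (extChartAt_target_mem_nhds' hy)).mdifferentiableAt (by simp)
  -- The vector field read in the chart at `x`.
  let pb (Z : Π x : M, TangentSpace 𝓘(ℝ, E) x) : E → E :=
    mpullbackWithin 𝓘(ℝ, E) 𝓘(ℝ, E) ψ Z (Set.range 𝓘(ℝ, E))
  have hset : ψ ⁻¹' Set.univ ∩ Set.range 𝓘(ℝ, E) = Set.univ := by simp
  have hpb {Z : Π x : M, TangentSpace 𝓘(ℝ, E) x} (hZ : MDifferentiableAt 𝓘(ℝ, E) 𝓘(ℝ, E).tangent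
      (fun y => (Z y : TangentBundle 𝓘(ℝ, E) M)) x) : DifferentiableAt ℝ (pb Z) e := by
    have : DifferentiableWithinAt ℝ (pb Z) (ψ ⁻¹' Set.univ ∩ Set.range 𝓘(ℝ, E)) e :=
      MDifferentiableWithinAt.differentiableWithinAt_mpullbackWithin_vectorField
        (mdifferentiableWithinAt_univ.2 hZ)
    rwa [hset, differentiableWithinAt_univ] at this
  have hpbe (Z : Π x : M, TangentSpace 𝓘(ℝ, E) x) : pb Z e = Z x := by
    have := mfderivWithin_extChartAt_symm_inverse_apply (I := 𝓘(ℝ, E)) (x := x) (Z x)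
    simp only [pb, mpullbackWithin]
    rw [hψe]
    exact this
  have chain (Z : Π x : M, TangentSpace 𝓘(ℝ, E) x) {G : M → A} {y : E}
      (hy : y ∈ (extChartAt 𝓘(ℝ, E) x).target)
      (hG : MDifferentiableAt 𝓘(ℝ, E) 𝓘(ℝ, A) G (ψ y)) :
      fderiv ℝ (G ∘ ψ) y (pb Z y) = differential E G (ψ y) (Z (ψ y)) := by
    have hinv : ((mfderivWithin 𝓘(ℝ, E) 𝓘(ℝ, E) ψ (Set.range 𝓘(ℝ, E)) y)
        (mpullbackWithin 𝓘(ℝ, E) 𝓘(ℝ, E) ψ Z (Set.range 𝓘(ℝ, E)) y)) = Z (ψ y) :=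
      (isInvertible_mfderivWithin_extChartAt_symm hy).self_apply_inverse (Z (ψ y))
    rw [modelWithCornersSelf_coe, Set.range_id, mfderivWithin_univ] at hinv
    rw [← mfderiv_eq_fderiv, mfderiv_comp (I' := 𝓘(ℝ, E)) y hG (hψd hy)]
    refine (congrArg (differential E G (ψ y)) ?_)
    simp only [pb, modelWithCornersSelf_coe, Set.range_id]
    exact hinv
  have hFd (y : M) : MDifferentiableAt 𝓘(ℝ, E) 𝓘(ℝ, A) F y := hF.mdifferentiable (by simp) y
  have hFc : ContDiffAt ℝ ∞ (F ∘ ψ) e := by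
    rw [← contMDiffAt_iff_contDiffAt]
    exact hF.contMDiffAt.comp e hψc
  have hbr : (mlieBracket 𝓘(ℝ, E) X Y x : E) = lieBracket ℝ (pb X) (pb Y) e := by
    have hid : differential E (extChartAt 𝓘(ℝ, E) x) x = ContinuousLinearMap.id ℝ E :=
      mfderiv_extChartAt_self
    change (differential E (extChartAt 𝓘(ℝ, E) x) x).inverse
      (lieBracketWithin ℝ (pb X) (pb Y) (ψ ⁻¹' Set.univ ∩ Set.range 𝓘(ℝ, E)) e) = _
    rw [hid, ContinuousLinearMap.inverse_id, hset, lieBracketWithin_univ]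
    rfl
  -- In the chart the identity rests on the symmetry of the second derivative of `F ∘ ψ`.
  have hmain := fderiv_apply_lieBracket hFc
    (by rw [minSmoothness_of_isRCLikeNormedField]; norm_cast) (hpb hY) (hpb hX)
  have hev (Z : Π x : M, TangentSpace 𝓘(ℝ, E) x) {gZ : M → A}
      (hZ : ∀ y, differential E F y (Z y) = gZ y) :
      (fun y => fderiv ℝ (F ∘ ψ) y (pb Z y)) =ᶠ[nhds e] gZ ∘ ψ := by
    filter_upwards [hnhds] with y hy
    rw [chain Z hy (hFd _), hZ, Function.comp_apply]
  rw [(hev X hgX).fderiv_eq, (hev Y hgY).fderiv_eq, hpbe, hpbe, ← hbr] at hmain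
  rw [← (hasFDerivAt_differential (hFd x)).fderiv, ← (hasFDerivAt_differential hdX).fderiv,
    ← (hasFDerivAt_differential hdY).fderiv]
  exact hmain

variable {K : Type*} [Group K]
  {V : Type*} [NormedAddCommGroup V] [InnerProductSpace ℂ V]

lemma toOperator_one (ρ : K →* (V ≃ₗᵢ[ℂ] V)) : toOperator ρ 1 = 1 := by
  ext v; simp [toOperator]

lemma differential_clm_comp {M : Type*} [TopologicalSpace M] [ChartedSpace E M]
    {A B : Type*} [NormedAddCommGroup A] [NormedSpace ℝ A] [NormedAddCommGroup B] [NormedSpace ℝ B]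
    (T : A →L[ℝ] B) {F : M → A} {x : M}
    (hF : MDifferentiableAt 𝓘(ℝ, E) 𝓘(ℝ, A) F x) (v : E) :
    differential E (T ∘ F) x v = T (differential E F x v) := by
  rw [differential, mfderiv_comp (I' := 𝓘(ℝ, A)) x T.mdifferentiableAt hF,
    ContinuousLinearMap.mfderiv_eq]
  rfl

variable [TopologicalSpace K] [ChartedSpace E K]

/-- The infinitesimal action is by skew-Hermitian operators. -/
lemma inner_infinitesimal_left (ρ : K →* (V ≃ₗᵢ[ℂ] V))
    (hρ : ContMDiff 𝓘(ℝ, E) 𝓘(ℝ, V →L[ℂ] V) ∞ (toOperator ρ))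
    (x : GroupLieAlgebra 𝓘(ℝ, E) K) (v w : V) :
    inner ℂ (infinitesimal ρ x v) w = -inner ℂ v (infinitesimal ρ x w) := by
  have hd : MDifferentiableAt 𝓘(ℝ, E) 𝓘(ℝ, V →L[ℂ] V) (toOperator ρ) (1 : K) :=
    hρ.mdifferentiable (by simp) 1
  have hf := hasFDerivAt_differential hd
  have hv (u : V) := ((ContinuousLinearMap.apply ℂ V u).restrictScalars ℝ).hasFDerivAt.comp
    (extChartAt 𝓘(ℝ, E) (1 : K) 1) hf
  have hin := (hv v).inner ℂ (hv w)
  -- By unitarity `⟨ρ(g) v, ρ(g) w⟩` is constant in `g`; its derivative at the identity is the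
  -- claim.
  have hconst : (fun y => inner ℂ
      ((((ContinuousLinearMap.apply ℂ V v).restrictScalars ℝ) ∘
        toOperator ρ ∘ (extChartAt 𝓘(ℝ, E) (1 : K)).symm) y)
      ((((ContinuousLinearMap.apply ℂ V w).restrictScalars ℝ) ∘
        toOperator ρ ∘ (extChartAt 𝓘(ℝ, E) (1 : K)).symm) y)) = fun _ => inner ℂ v w := by
    ext y
    simp [toOperator]
  have h0 := congrArg (· x) ((hconst ▸ hin).unique (hasFDerivAt_const _ _))
  have h1 : inner ℂ (toOperator ρ ((extChartAt 𝓘(ℝ, E) (1 : K)).symm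
        (extChartAt 𝓘(ℝ, E) (1 : K) 1)) v) (infinitesimal ρ x w)
      + inner ℂ (infinitesimal ρ x v) (toOperator ρ ((extChartAt 𝓘(ℝ, E) (1 : K)).symm
        (extChartAt 𝓘(ℝ, E) (1 : K) 1)) w) = 0 := h0
  rw [extChartAt_to_inv, toOperator_one] at h1
  exact eq_neg_of_add_eq_zero_right h1

variable [LieGroup 𝓘(ℝ, E) ∞ K]

/-- Differentiate `ρ(g k) = ρ(g) ρ(k)` in `k` at `k = 1`. -/
lemma differential_toOperator_mulInvariantVectorField (ρ : K →* (V ≃ₗᵢ[ℂ] V))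
    (hρ : ContMDiff 𝓘(ℝ, E) 𝓘(ℝ, V →L[ℂ] V) ∞ (toOperator ρ))
    (x : GroupLieAlgebra 𝓘(ℝ, E) K) (g : K) :
    differential E (toOperator ρ) g (mulInvariantVectorField x g)
      = toOperator ρ g * infinitesimal ρ x := by
  have hd (g : K) : MDifferentiableAt 𝓘(ℝ, E) 𝓘(ℝ, V →L[ℂ] V) (toOperator ρ) g :=
    hρ.mdifferentiable (by simp) g
  have hm : MDifferentiableAt 𝓘(ℝ, E) 𝓘(ℝ, E) (g * · : K → K) 1 :=
    (contMDiff_mul_left (I := 𝓘(ℝ, E)) (n := ∞)).mdifferentiable (by simp) 1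
  have h1 : (toOperator ρ) ∘ (g * · : K → K)
      = (ContinuousLinearMap.mul ℝ (V →L[ℂ] V) (toOperator ρ g)) ∘ toOperator ρ := by
    ext k v
    simp [toOperator]
  have h2 := differential_clm_comp (ContinuousLinearMap.mul ℝ (V →L[ℂ] V) (toOperator ρ g)) (hd 1) x
  rw [← h1, differential, mfderiv_comp (I' := 𝓘(ℝ, E)) 1 (hd (g * 1)) hm] at h2
  have h3 : differential E (toOperator ρ) (g * 1) (mulInvariantVectorField x g)
      = toOperator ρ g * infinitesimal ρ x := h2
  rwa [mul_one] at h3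

/-- The infinitesimal action is a homomorphism of Lie algebras. -/
lemma infinitesimal_lie [FiniteDimensional ℝ E] (ρ : K →* (V ≃ₗᵢ[ℂ] V))
    (hρ : ContMDiff 𝓘(ℝ, E) 𝓘(ℝ, V →L[ℂ] V) ∞ (toOperator ρ))
    (x y : GroupLieAlgebra 𝓘(ℝ, E) K) :
    infinitesimal ρ ⁅x, y⁆
      = infinitesimal ρ x * infinitesimal ρ y - infinitesimal ρ y * infinitesimal ρ x := by
  have : CompleteSpace E := FiniteDimensional.complete ℝ E
  have : IsManifold 𝓘(ℝ, E) ∞ K := LieGroup.toContMDiffMul.toIsManifold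
  have hd (g : K) : MDifferentiableAt 𝓘(ℝ, E) 𝓘(ℝ, V →L[ℂ] V) (toOperator ρ) g :=
    hρ.mdifferentiable (by simp) g
  let R (a : V →L[ℂ] V) : (V →L[ℂ] V) →L[ℝ] (V →L[ℂ] V) :=
    (ContinuousLinearMap.mul ℝ (V →L[ℂ] V)).flip a
  have hg (z : GroupLieAlgebra 𝓘(ℝ, E) K) (g : K) :
      differential E (toOperator ρ) g (mulInvariantVectorField z g)
        = (R (infinitesimal ρ z) ∘ toOperator ρ) g :=
    differential_toOperator_mulInvariantVectorField ρ hρ z g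
  have hRd (a : V →L[ℂ] V) :
      MDifferentiableAt 𝓘(ℝ, E) 𝓘(ℝ, V →L[ℂ] V) (R a ∘ toOperator ρ) (1 : K) :=
    (R a).mdifferentiableAt.comp 1 (hd 1)
  -- Along the left-invariant field of `z` the derivative of `ρ` is `ρ` times `dρ(z)` on the right;
  -- differentiating again at `1` gives the products in the commutator.
  have h := differential_mlieBracket hρ (x := 1) (mdifferentiableAt_mulInvariantVectorField x)
    (mdifferentiableAt_mulInvariantVectorField y) (hg x) (hg y) (hRd _) (hRd _)
  have hinv (z : GroupLieAlgebra 𝓘(ℝ, E) K) :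
      differential E (toOperator ρ) 1 (mulInvariantVectorField z 1) = infinitesimal ρ z := by
    rw [hg, Function.comp_apply, toOperator_one]
    exact one_mul _
  have hR (a : V →L[ℂ] V) (v : E) :
      differential E (R a ∘ toOperator ρ) (1 : K) v = differential E (toOperator ρ) (1 : K) v * a :=
    differential_clm_comp (R a) (hd 1) v
  have h' := h.trans (congrArg₂ (· - ·) (hR _ (mulInvariantVectorField x 1))
    (hR _ (mulInvariantVectorField y 1)))
  rw [hinv, hinv] at h'
  exact h'

end LieGroup
end MomentumMap

namespace MomentumMap

/-! ### Weight spaces and matrix coefficients. -/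

section Weights

variable {𝔨 : Type*} [LieRing 𝔨] [LieAlgebra ℝ 𝔨]
  {V : Type*} [NormedAddCommGroup V] [InnerProductSpace ℂ V]
  {φ : 𝔨 →ₗ[ℝ] (V →L[ℂ] V)} {𝔱 : LieSubalgebra ℝ 𝔨}

lemma mem_weightSpace {ν : Module.Dual ℝ 𝔱} {v : V} :
    v ∈ weightSpace φ 𝔱 ν ↔ ∀ h : 𝔱, φ (h : 𝔨) v = (Complex.I * (ν h : ℂ)) • v := by
  simp [weightSpace, Submodule.mem_iInf]

/-- `φ` acts by skew-Hermitian operators. -/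
def IsSkew (φ : 𝔨 →ₗ[ℝ] (V →L[ℂ] V)) : Prop :=
  ∀ (x : 𝔨) (v w : V), inner ℂ (φ x v) w = -inner ℂ v (φ x w)

/-- `φ` is a representation of the Lie algebra. -/
def IsRepresentation (φ : 𝔨 →ₗ[ℝ] (V →L[ℂ] V)) : Prop :=
  ∀ x y : 𝔨, φ ⁅x, y⁆ = φ x * φ y - φ y * φ x

lemma IsSkew.inner_weight_left (hφ : IsSkew φ) {μ : Module.Dual ℝ 𝔱} {u : V}
    (hu : u ∈ weightSpace φ 𝔱 μ) (h : 𝔱) (w : V) :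
    inner ℂ u (φ (h : 𝔨) w) = Complex.I * (μ h : ℂ) * inner ℂ u w := by
  rw [← neg_eq_iff_eq_neg.2 (hφ h u w), mem_weightSpace.1 hu h, inner_smul_left]
  simp

lemma IsSkew.inner_eq_zero_of_weight_ne (hφ : IsSkew φ) {μ ν : Module.Dual ℝ 𝔱} (hμν : μ ≠ ν)
    {u v : V} (hu : u ∈ weightSpace φ 𝔱 μ) (hv : v ∈ weightSpace φ 𝔱 ν) : inner ℂ u v = 0 := by
  obtain ⟨h, hh⟩ : ∃ h, μ h ≠ ν h := by
    by_contra! H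
    exact hμν (LinearMap.ext H)
  have h₁ := hφ.inner_weight_left hu h v
  rw [mem_weightSpace.1 hv h, inner_smul_right] at h₁
  have h₂ : Complex.I * ((ν h : ℂ) - μ h) * inner ℂ u v = 0 := by linear_combination h₁
  refine (mul_eq_zero.1 h₂).resolve_left (mul_ne_zero Complex.I_ne_zero (sub_ne_zero.2 ?_))
  exact_mod_cast hh.symm

/-- Expand the commutator and let `h` act on `v` and, by skewness, on `u`. Thus the matrix
coefficient is a `𝔱`-eigenfunctional on `𝔨`. -/
lemma IsRepresentation.inner_lie (hrep : IsRepresentation φ) (hφ : IsSkew φ)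
    {μ ν : Module.Dual ℝ 𝔱} {u v : V}
    (hu : u ∈ weightSpace φ 𝔱 μ) (hv : v ∈ weightSpace φ 𝔱 ν) (h : 𝔱) (x : 𝔨) :
    inner ℂ u (φ ⁅(h : 𝔨), x⁆ v)
      = Complex.I * (((μ - ν) h : ℝ) : ℂ) * inner ℂ u (φ x v) := by
  rw [hrep, sub_apply, inner_sub_right, mul_apply_eq_comp,
    mul_apply_eq_comp, hφ.inner_weight_left hu, mem_weightSpace.1 hv h, map_smul,
    inner_smul_right, LinearMap.sub_apply]
  push_cast
  ring

/-- The matrix coefficient `x ↦ ⟨φ(x) v, u⟩`. -/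
noncomputable def matrixCoeff (φ : 𝔨 →ₗ[ℝ] (V →L[ℂ] V)) (u v : V) : 𝔨 →ₗ[ℝ] ℂ where
  toFun x := inner ℂ u (φ x v)
  map_add' x y := by simp
  map_smul' c x := by
    rw [map_smul, smul_apply, ← Complex.coe_smul, inner_smul_right]
    rfl

lemma weights_finite [FiniteDimensional ℂ V] (hφ : IsSkew φ) : (weights φ 𝔱).Finite := by
  have h (ν : weights φ 𝔱) : ∃ v ∈ weightSpace φ 𝔱 ν, v ≠ 0 := (Submodule.ne_bot_iff _).1 ν.2
  choose u hu hu0 using h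
  have hli : LinearIndependent ℂ u := linearIndependent_of_ne_zero_of_inner_eq_zero hu0
    fun μ ν hμν => hφ.inner_eq_zero_of_weight_ne (fun h => hμν (Subtype.ext h)) (hu μ) (hu ν)
  exact hli.finite

variable [FiniteDimensional ℝ 𝔨] [LieAlgebra.IsKilling ℝ 𝔨]

/-- The real and imaginary parts of the matrix coefficient, a nonzero eigenfunctional, feed
`neg_mem_roots_of_dual`. -/
lemma IsRepresentation.sub_mem_roots (hrep : IsRepresentation φ) (hφ : IsSkew φ)
    {μ ν : Module.Dual ℝ 𝔱} (hμν : μ ≠ ν) {u v : V}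
    (hu : u ∈ weightSpace φ 𝔱 μ) (hv : v ∈ weightSpace φ 𝔱 ν) {x : 𝔨}
    (hx : inner ℂ u (φ x v) ≠ 0) : ν - μ ∈ roots 𝔱 := by
  rw [← neg_sub]
  have hc (h : 𝔱) (y : 𝔨) : matrixCoeff φ u v ⁅(h : 𝔨), y⁆
      = Complex.I * (((μ - ν) h : ℝ) : ℂ) * matrixCoeff φ u v y := hrep.inner_lie hφ hu hv h y
  refine neg_mem_roots_of_dual 𝔱 (sub_ne_zero.2 hμν)
    (ℓ₁ := Complex.reLm ∘ₗ matrixCoeff φ u v) (ℓ₂ := Complex.imLm ∘ₗ matrixCoeff φ u v)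
    (fun h y => ?_) (fun h y => ?_) ?_
  · simp [hc]
    ring
  · simp [hc]
  · by_contra! H
    exact hx (Complex.ext (LinearMap.congr_fun H.1 x) (LinearMap.congr_fun H.2 x))

end Weights

/-! ### Derivatives of the momentum map and of its squared norm. -/

section Momentum

lemma inner_self_eq_ofReal {V : Type*} [NormedAddCommGroup V] [InnerProductSpace ℂ V] (v : V) :
    inner ℂ v v = ((‖v‖ ^ 2 : ℝ) : ℂ) := by
  rw [inner_self_eq_norm_sq_to_K]
  push_cast
  rfl

variable {𝔨 : Type*} [LieRing 𝔨] [LieAlgebra ℝ 𝔨]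
  {V : Type*} [NormedAddCommGroup V] [InnerProductSpace ℂ V]
  {φ : 𝔨 →ₗ[ℝ] (V →L[ℂ] V)}

lemma momentumVec_apply (v : V) (x : 𝔨) :
    momentumVec φ v x = (inner ℂ v (φ x v)).im * (‖v‖ ^ 2)⁻¹ := by
  change ((1 / Complex.I) * (inner ℂ v (φ x v) / inner ℂ v v)).re = _
  rw [inner_self_eq_ofReal, ← div_eq_mul_inv, one_div, Complex.inv_I, neg_mul, Complex.neg_re,
    Complex.I_mul_re,
    Complex.div_ofReal_im,
    neg_neg]

lemma differentiableAt_inv_norm_sq {v : V} (hv : v ≠ 0) :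
    DifferentiableAt ℝ (fun u : V => (‖u‖ ^ 2)⁻¹) v :=
  (differentiableAt_fun_id.norm_sq ℂ).inv (by simpa using hv)

lemma differentiableAt_momentumVec {v : V} (hv : v ≠ 0) (x : 𝔨) :
    DifferentiableAt ℝ (fun u => momentumVec φ u x) v := by
  have hx : DifferentiableAt ℝ (fun u : V => φ x u) v :=
    ((φ x).restrictScalars ℝ).differentiableAt
  have hN : DifferentiableAt ℝ (fun u : V => inner ℂ u (φ x u)) v :=
    differentiableAt_fun_id.inner ℂ hx
  have hI : DifferentiableAt ℝ (fun u : V => (inner ℂ u (φ x u)).im) v :=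
    Complex.imCLM.differentiableAt.comp v hN
  simp only [momentumVec_apply]
  exact hI.mul (differentiableAt_inv_norm_sq hv)

/-- The component `μ(·)(h)` of the momentum map is critical at the eigenvectors of `h`. -/
lemma hasFDerivAt_momentumVec_of_eigenvector (hφ : IsSkew φ) {v : V} (hv : v ≠ 0) {h : 𝔨} {c : ℝ}
    (hc : φ h v = (Complex.I * (c : ℂ)) • v) :
    HasFDerivAt (fun u => momentumVec φ u h) (0 : V →L[ℝ] ℝ) v := by
  -- Since `c` is real, the shifted operator is still skew, and it kills `v`; it changes the
  -- momentum component only by the constant `c`.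
  set T : V →L[ℂ] V := φ h - (Complex.I * (c : ℂ)) • 1
  have hTv : T v = 0 := by simp [T, hc]
  have hT (u w : V) : inner ℂ (T u) w = -inner ℂ u (T w) := by
    simp only [T, sub_apply, smul_apply, one_apply_eq_self, inner_sub_left,
      inner_sub_right, inner_smul_left, inner_smul_right, hφ h u w]
    simp
    ring
  -- The form depends only on `u - v`, hence vanishes to second order at `v`.
  have hquad (u : V) : inner ℂ (u - v) (T (u - v)) = inner ℂ u (T u) := by
    rw [map_sub, hTv, sub_zero, inner_sub_left, ← neg_eq_iff_eq_neg.2 (hT v u), hTv]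
    simp
  have hsub : HasFDerivAt (fun u : V => u - v) (ContinuousLinearMap.id ℝ V) v :=
    (hasFDerivAt_id v).sub_const v
  have hTsub : HasFDerivAt (fun u : V => T (u - v)) (T.restrictScalars ℝ) v := by
    exact (T.restrictScalars ℝ).hasFDerivAt.comp v hsub
  have hN : HasFDerivAt (fun u : V => inner ℂ u (T u)) (0 : V →L[ℝ] ℂ) v := by
    have := hsub.inner ℂ hTsub
    simp only [hquad] at this
    have h0 : (fderivInnerCLM ℂ (v - v, T (v - v))).comp
        ((ContinuousLinearMap.id ℝ V).prod (T.restrictScalars ℝ)) = 0 := by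
      ext w
      simp
    rw [h0] at this
    exact this
  have hI : HasFDerivAt (fun u : V => (inner ℂ u (T u)).im) (0 : V →L[ℝ] ℝ) v := by
    have := Complex.imCLM.hasFDerivAt.comp v hN
    rw [ContinuousLinearMap.comp_zero] at this
    exact this
  have hq := (hI.mul (differentiableAt_inv_norm_sq hv).hasFDerivAt).add_const c
  rw [hTv, inner_zero_right, Complex.zero_im, zero_smul, smul_zero, add_zero] at hq
  refine hq.congr_of_eventuallyEq ?_
  filter_upwards [isOpen_ne.mem_nhds hv] with u hu
  have hu' : ‖u‖ ≠ 0 := norm_ne_zero_iff.2 hu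
  have hTu : (inner ℂ u (φ h u)).im = (inner ℂ u (T u)).im + c * ‖u‖ ^ 2 := by
    simp only [T, sub_apply, smul_apply, one_apply_eq_self, inner_sub_right, inner_smul_right,
      inner_self_eq_norm_sq_to_K, Complex.coe_algebraMap, ← Complex.ofReal_pow, mul_assoc,
      ← Complex.ofReal_mul, Complex.sub_im, Complex.I_mul_im, Complex.ofReal_re, sub_add_cancel]
  simp only [momentumVec_apply, hTu, Pi.mul_apply]
  field_simp

variable [FiniteDimensional ℝ 𝔨] [LieAlgebra.IsKilling ℝ 𝔨]

/-- Reduces derivatives of `innerDual` to those of the scalar components `μ(·)(x)`. -/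
lemma exists_innerDual_eq_sum : ∃ (n : ℕ) (b y : Fin n → 𝔨), ∀ f g : Module.Dual ℝ 𝔨,
    innerDual f g = ∑ j, g (b j) * f (y j) := by
  let b := Module.finBasis ℝ 𝔨
  refine ⟨_, b, fun j => -((killingForm ℝ 𝔨).toDual
    (LieAlgebra.IsKilling.killingForm_nondegenerate ℝ 𝔨)).symm (b.coord j), fun f g => ?_⟩
  rw [innerDual]
  conv_lhs => rw [← b.sum_dual_apply_smul_coord g]
  simp only [map_sum, map_smul, map_neg, smul_eq_mul, mul_neg, Finset.sum_neg_distrib]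

lemma hasFDerivAt_mul_of_eq_zero {f g : V → ℝ} {v : V} (hf : DifferentiableAt ℝ f v)
    (hg : DifferentiableAt ℝ g v) (hf0 : f v = 0) (hg0 : g v = 0) :
    HasFDerivAt (fun u => f u * g u) (0 : V →L[ℝ] ℝ) v := by
  have := hf.hasFDerivAt.mul hg.hasFDerivAt
  rw [hf0, hg0, zero_smul, zero_smul, add_zero] at this
  exact this

lemma pullback_momentumNormSq {v : V} (hv : v ≠ 0) :
    pullback (momentumNormSq φ) v = innerDual (momentumVec φ v) (momentumVec φ v) := by
  rw [pullback, dif_pos hv]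
  rfl

/-- Expand about `μ(v)` by `innerDual_self_eq`. The quadratic term is a sum of products of functions
vanishing at `v`; the linear term is `-2 (μ(u) - μ(v))(h)`, stationary because `v` is an eigenvector
of `h`. -/
lemma hasFDerivAt_pullback_momentumNormSq (hφ : IsSkew φ) {v : V} (hv : v ≠ 0) {h : 𝔨} {c : ℝ}
    (hc : φ h v = (Complex.I * (c : ℂ)) • v) (hm : momentumVec φ v = killingForm ℝ 𝔨 h) :
    HasFDerivAt (pullback (momentumNormSq φ)) (0 : V →L[ℝ] ℝ) v := by
  obtain ⟨n, b, y, hby⟩ := exists_innerDual_eq_sum (𝔨 := 𝔨)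
  have hd (x : 𝔨) : DifferentiableAt ℝ (fun u => (momentumVec φ u - momentumVec φ v) x) v :=
    (differentiableAt_momentumVec hv x).sub_const _
  have h₂ : HasFDerivAt
      (fun u => innerDual (momentumVec φ u - momentumVec φ v) (momentumVec φ u - momentumVec φ v))
      (0 : V →L[ℝ] ℝ) v := by
    simp only [hby]
    have := HasFDerivAt.fun_sum (u := Finset.univ) fun j _ =>
      hasFDerivAt_mul_of_eq_zero (hd (b j)) (hd (y j)) (by simp) (by simp)
    simpa using this
  have h₁ : HasFDerivAt (fun u => 2 * innerDual (momentumVec φ u - momentumVec φ v)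
      (momentumVec φ v)) (0 : V →L[ℝ] ℝ) v := by
    have := (((hasFDerivAt_momentumVec_of_eigenvector hφ hv hc).sub_const
      (momentumVec φ v h)).neg).const_mul 2
    rw [neg_zero, smul_zero] at this
    refine this.congr_of_eventuallyEq (Filter.Eventually.of_forall fun u => ?_)
    change 2 * innerDual (momentumVec φ u - momentumVec φ v) (momentumVec φ v)
      = 2 * -(momentumVec φ u h - momentumVec φ v h)
    conv_lhs => rw [hm, innerDual_killingForm, ← hm]
    rfl
  have h := (h₁.const_add (innerDual (momentumVec φ v) (momentumVec φ v))).add h₂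
  rw [add_zero] at h
  refine h.congr_of_eventuallyEq ?_
  filter_upwards [isOpen_ne.mem_nhds hv] with u hu
  rw [pullback_momentumNormSq hu, innerDual_self_eq _ (momentumVec φ v)]
  rfl

variable {𝔱 : LieSubalgebra ℝ 𝔨} [𝔱.IsCartanSubalgebra]

lemma mk_mem_criticalSet (hφ : IsSkew φ) {ξ : Module.Dual ℝ 𝔱} {v : V} (hv : v ≠ 0) {c : ℝ}
    (hm : momentumVec φ v = cartanDualEmbedding 𝔱 ξ)
    (hc : φ ((LieAlgebra.IsKilling.cartanEquivDual 𝔱).symm ξ : 𝔨) v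
      = (Complex.I * (c : ℂ)) • v) :
    Projectivization.mk ℂ v hv ∈ criticalSet φ 𝔱 ξ := by
  refine ⟨hm, fun u hu huv => ?_⟩
  -- Every representative must be treated; both hypotheses are invariant under scaling.
  obtain ⟨a, rfl⟩ := (Projectivization.mk_eq_mk_iff' ℂ u v hu hv).1 huv
  have ha : a ≠ 0 := fun h => hu (by rw [h, zero_smul])
  refine hasFDerivAt_pullback_momentumNormSq hφ hu (c := c) ?_
    ((momentumVec_smul φ ha v).trans hm)
  rw [map_smul, hc, smul_comm]

end Momentum

end MomentumMap

namespace MomentumMap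

/-! ### Critical points from root-distinct sets of weights. -/

section CriticalPoints

variable {𝔨 : Type*} [LieRing 𝔨] [LieAlgebra ℝ 𝔨]
  {V : Type*} [NormedAddCommGroup V] [InnerProductSpace ℂ V]
  {φ : 𝔨 →ₗ[ℝ] (V →L[ℂ] V)} {𝔱 : LieSubalgebra ℝ 𝔨}

/-- Pythagoras for the weight space decomposition. -/
lemma IsSkew.inner_sum_weights (hφ : IsSkew φ) (S : Finset (Module.Dual ℝ 𝔱))
    {u w : Module.Dual ℝ 𝔱 → V} (hu : ∀ ν ∈ S, u ν ∈ weightSpace φ 𝔱 ν)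
    (hw : ∀ ν ∈ S, w ν ∈ weightSpace φ 𝔱 ν) :
    inner ℂ (∑ ν ∈ S, u ν) (∑ ν ∈ S, w ν) = ∑ ν ∈ S, inner ℂ (u ν) (w ν) := by
  rw [sum_inner]
  refine Finset.sum_congr rfl fun μ hμ => ?_
  rw [inner_sum]
  exact Finset.sum_eq_single_of_mem μ hμ fun ν hν hνμ =>
    hφ.inner_eq_zero_of_weight_ne hνμ.symm (hu μ hμ) (hw ν hν)

lemma exists_unit_weight_vectors (S : Set (Module.Dual ℝ 𝔱)) (hS : S ⊆ weights φ 𝔱) :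
    ∃ w : Module.Dual ℝ 𝔱 → V, ∀ ν ∈ S, w ν ∈ weightSpace φ 𝔱 ν ∧ ‖w ν‖ = 1 := by
  have h (ν : Module.Dual ℝ 𝔱) : ∃ w : V, ν ∈ S → w ∈ weightSpace φ 𝔱 ν ∧ ‖w‖ = 1 := by
    by_cases hν : ν ∈ S
    · obtain ⟨v, hv, hv0⟩ := (Submodule.ne_bot_iff _).1 (hS hν)
      exact ⟨((‖v‖⁻¹ : ℝ) : ℂ) • v, fun _ => ⟨Submodule.smul_mem _ _ hv, by
        rw [norm_smul, Complex.norm_real, norm_inv, norm_norm,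
          inv_mul_cancel₀ (norm_ne_zero_iff.2 hv0)]⟩⟩
    · exact ⟨0, fun h => absurd h hν⟩
  choose w hw using h
  exact ⟨w, fun ν => hw ν⟩

variable [FiniteDimensional ℝ 𝔨] [LieAlgebra.IsKilling ℝ 𝔨]

lemma RootDistinct.inner_eq_zero {M : Set (Module.Dual ℝ 𝔱)} (hM : RootDistinct 𝔱 M)
    (hrep : IsRepresentation φ) (hφ : IsSkew φ) {μ ν : Module.Dual ℝ 𝔱} (hμ : μ ∈ M) (hν : ν ∈ M)
    (hμν : μ ≠ ν) {u v : V} (hu : u ∈ weightSpace φ 𝔱 μ) (hv : v ∈ weightSpace φ 𝔱 ν) (x : 𝔨) :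
    inner ℂ u (φ x v) = 0 := by
  by_contra hx
  have : ν ∈ M ∩ (roots 𝔱 + M) :=
    ⟨hν, Set.mem_add.2 ⟨ν - μ, hrep.sub_mem_roots hφ hμν hu hv hx, μ, hμ, sub_add_cancel _ _⟩⟩
  rw [hM] at this
  exact this

variable [𝔱.IsCartanSubalgebra]

lemma IsRegular.rootDistinct_weightsAt {ξ : Module.Dual ℝ 𝔱} (hξ : IsRegular 𝔱 ξ) :
    RootDistinct 𝔱 (weightsAt φ 𝔱 ξ) := by
  rw [RootDistinct, Set.eq_empty_iff_forall_notMem]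
  rintro _ ⟨hν, α, hα, μ, hμ, rfl⟩
  refine hξ α hα ?_
  have h : innerCartanLeft 𝔱 ξ (α + μ) = innerCartanLeft 𝔱 ξ μ := hν.2.trans hμ.2.symm
  rwa [map_add, add_eq_right] at h

/-- The momentum of a combination of weight vectors for a root-distinct set of weights. -/
lemma RootDistinct.momentumVec_sum {S : Finset (Module.Dual ℝ 𝔱)}
    (hS : RootDistinct 𝔱 (S : Set (Module.Dual ℝ 𝔱)))
    (hrep : IsRepresentation φ) (hφ : IsSkew φ)
    {u : Module.Dual ℝ 𝔱 → V} (hu : ∀ ν ∈ S, u ν ∈ weightSpace φ 𝔱 ν)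
    (hnorm : ∑ ν ∈ S, ‖u ν‖ ^ 2 = 1) :
    momentumVec φ (∑ ν ∈ S, u ν) = cartanDualEmbedding 𝔱 (∑ ν ∈ S, ‖u ν‖ ^ 2 • ν) := by
  have hv : ‖∑ ν ∈ S, u ν‖ ^ 2 = 1 := by
    rw [← hnorm, ← inner_self_eq_norm_sq (𝕜 := ℂ), hφ.inner_sum_weights S hu hu]
    simp only [map_sum, inner_self_eq_norm_sq]
  refine eq_cartanDualEmbedding 𝔱 (fun h x => ?_) (fun h => ?_)
  -- Off-diagonal terms vanish by root-distinctness, diagonal ones because their `𝔱`-weight is `μ -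
  -- μ = 0`.
  · have hzero : inner ℂ (∑ ν ∈ S, u ν) (φ ⁅(h : 𝔨), x⁆ (∑ ν ∈ S, u ν)) = 0 := by
      rw [map_sum, sum_inner]
      refine Finset.sum_eq_zero fun μ hμ => ?_
      rw [inner_sum]
      refine Finset.sum_eq_zero fun ν hν => ?_
      by_cases hμν : μ = ν
      · subst hμν
        rw [hrep.inner_lie hφ (hu μ hμ) (hu μ hμ), sub_self]
        simp
      · exact hS.inner_eq_zero hrep hφ hμ hν hμν (hu μ hμ) (hu ν hν) _
    rw [momentumVec_apply, hzero]
    simp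
  · have hw (ν : Module.Dual ℝ 𝔱) (hν : ν ∈ S) : φ (h : 𝔨) (u ν) ∈ weightSpace φ 𝔱 ν := by
      rw [mem_weightSpace.1 (hu ν hν) h]
      exact Submodule.smul_mem _ _ (hu ν hν)
    rw [momentumVec_apply, hv, map_sum, hφ.inner_sum_weights S hu hw, Complex.im_sum, inv_one,
      mul_one, LinearMap.sum_apply]
    refine Finset.sum_congr rfl fun ν hν => ?_
    rw [mem_weightSpace.1 (hu ν hν) h, inner_smul_right, inner_self_eq_ofReal, mul_assoc,
      ← Complex.ofReal_mul,
      Complex.I_mul_im, Complex.ofReal_re, LinearMap.smul_apply, smul_eq_mul, mul_comm]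

/-- The scalar is the same for all `ν` in `Λ_ξ`, so sums over `Λ_ξ` are eigenvectors too. The sign
arises because `ξ` is represented through the Killing form, the inner product being its negative. -/
lemma apply_cartanEquivDual_symm {ξ ν : Module.Dual ℝ 𝔱} (hν : ν ∈ weightsAt φ 𝔱 ξ) {v : V}
    (hv : v ∈ weightSpace φ 𝔱 ν) :
    φ ((LieAlgebra.IsKilling.cartanEquivDual 𝔱).symm ξ : 𝔨) v
      = (Complex.I * ((-innerCartan 𝔱 ξ ξ : ℝ) : ℂ)) • v := by
  rw [mem_weightSpace.1 hv, ← hν.2, innerCartan, neg_neg]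

/-- A convex combination `ξ` of a root-distinct set of weights on the hyperplane `(ν | ξ) = ‖ξ‖²`
is the momentum of the corresponding critical points. -/
lemma mk_sum_mem_criticalSet {ξ : Module.Dual ℝ 𝔱}
    {S : Finset (Module.Dual ℝ 𝔱)} (hSξ : (S : Set (Module.Dual ℝ 𝔱)) = weightsAt φ 𝔱 ξ)
    (hS : RootDistinct 𝔱 (weightsAt φ 𝔱 ξ)) (hrep : IsRepresentation φ) (hφ : IsSkew φ)
    {a : Module.Dual ℝ 𝔱 → ℝ} {w : Module.Dual ℝ 𝔱 → V} (ha : ∀ ν ∈ S, 0 ≤ a ν)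
    (ha1 : ∑ ν ∈ S, a ν = 1) (haξ : ∑ ν ∈ S, a ν • ν = ξ)
    (hw : ∀ ν ∈ S, w ν ∈ weightSpace φ 𝔱 ν ∧ ‖w ν‖ = 1) :
    ∃ hv : ∑ ν ∈ S, ((Real.sqrt (a ν) : ℝ) : ℂ) • w ν ≠ 0,
      Projectivization.mk ℂ (∑ ν ∈ S, ((Real.sqrt (a ν) : ℝ) : ℂ) • w ν) hv
        ∈ criticalSet φ 𝔱 ξ := by
  set u : Module.Dual ℝ 𝔱 → V := fun ν => ((Real.sqrt (a ν) : ℝ) : ℂ) • w ν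
  have hu (ν : Module.Dual ℝ 𝔱) (hν : ν ∈ S) : u ν ∈ weightSpace φ 𝔱 ν :=
    Submodule.smul_mem _ _ (hw ν hν).1
  have hn (ν : Module.Dual ℝ 𝔱) (hν : ν ∈ S) : ‖u ν‖ ^ 2 = a ν := by
    rw [norm_smul, (hw ν hν).2, mul_one, Complex.norm_real,
      Real.norm_of_nonneg (Real.sqrt_nonneg _),
      Real.sq_sqrt (ha ν hν)]
  have hnorm : ∑ ν ∈ S, ‖u ν‖ ^ 2 = 1 := by rw [Finset.sum_congr rfl hn, ha1]
  have hv : ∑ ν ∈ S, u ν ≠ 0 := by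
    intro h0
    have h := congrArg RCLike.re (hφ.inner_sum_weights S hu hu)
    rw [h0, inner_zero_left, map_zero, map_sum] at h
    simp only [inner_self_eq_norm_sq, hnorm] at h
    exact zero_ne_one h
  refine ⟨hv, mk_mem_criticalSet hφ hv (c := -innerCartan 𝔱 ξ ξ) ?_ ?_⟩
  · rw [(hSξ ▸ hS : RootDistinct 𝔱 (S : Set (Module.Dual ℝ 𝔱))).momentumVec_sum hrep hφ hu hnorm,
      Finset.sum_congr rfl fun ν hν => by rw [hn ν hν], haξ]
  · rw [map_sum, Finset.smul_sum]
    exact Finset.sum_congr rfl fun ν hν =>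
      apply_cartanEquivDual_symm (hSξ ▸ Finset.mem_coe.2 hν) (hu ν hν)

lemma exists_convex_combination {ξ : Module.Dual ℝ 𝔱} (hξ : ξ ∈ closestPoints φ 𝔱)
    {S : Finset (Module.Dual ℝ 𝔱)} (hSξ : (S : Set (Module.Dual ℝ 𝔱)) = weightsAt φ 𝔱 ξ) :
    ∃ a : Module.Dual ℝ 𝔱 → ℝ,
      (∀ ν ∈ S, 0 ≤ a ν) ∧ ∑ ν ∈ S, a ν = 1 ∧ ∑ ν ∈ S, a ν • ν = ξ := by
  obtain ⟨M, hM, hcl⟩ := hξ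
  have hmem : ξ ∈ convexHull ℝ (S : Set (Module.Dual ℝ 𝔱)) :=
    convexHull_mono (fun ν hν => hSξ ▸ ⟨hM hν.1, hν.2⟩) (hcl.mem_convexHull 𝔱)
  obtain ⟨a, ha, ha1, haξ⟩ := Finset.mem_convexHull.1 hmem
  exact ⟨a, ha, ha1, by rwa [Finset.centerMass_eq_of_sum_1 _ _ ha1] at haξ⟩

end CriticalPoints

end MomentumMap

open MomentumMap in
theorem mainTheorem7
    {E : Type*} [NormedAddCommGroup E] [NormedSpace ℝ E] [FiniteDimensional ℝ E]
    {K : Type*} [TopologicalSpace K] [T2Space K] [CompactSpace K] [ConnectedSpace K]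
    [ChartedSpace E K] [Group K] [LieGroup 𝓘(ℝ, E) ∞ K]
    [LieAlgebra.IsSemisimple ℝ (GroupLieAlgebra 𝓘(ℝ, E) K)]
    (𝔱 : LieSubalgebra ℝ (GroupLieAlgebra 𝓘(ℝ, E) K)) [𝔱.IsCartanSubalgebra]
    {V : Type*} [NormedAddCommGroup V] [InnerProductSpace ℂ V] [FiniteDimensional ℂ V]
    (ρ : K →* (V ≃ₗᵢ[ℂ] V))
    (hρ : ContMDiff 𝓘(ℝ, E) 𝓘(ℝ, V →L[ℂ] V) ∞ (toOperator ρ))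
    (ξ : Module.Dual ℝ 𝔱)
    (hξ : ξ ∈ closestPoints (infinitesimal ρ) 𝔱)
    (hreg : IsRegular 𝔱 ξ) :
    IsIntermediateCriticalValue (infinitesimal ρ) 𝔱 ξ ∧
    RootDistinct 𝔱 (weightsAt (infinitesimal ρ) 𝔱 ξ) ∧
    (weightsAt (infinitesimal ρ) 𝔱 ξ).Finite ∧
    (∃ a : Module.Dual ℝ 𝔱 → ℝ,
      (∀ ν ∈ weightsAt (infinitesimal ρ) 𝔱 ξ, 0 ≤ a ν) ∧
      ∑ᶠ ν ∈ weightsAt (infinitesimal ρ) 𝔱 ξ, a ν = 1 ∧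
      ∑ᶠ ν ∈ weightsAt (infinitesimal ρ) 𝔱 ξ, a ν • ν = ξ) ∧
    ∀ (a : Module.Dual ℝ 𝔱 → ℝ) (w : Module.Dual ℝ 𝔱 → V),
      (∀ ν ∈ weightsAt (infinitesimal ρ) 𝔱 ξ, 0 ≤ a ν) →
      ∑ᶠ ν ∈ weightsAt (infinitesimal ρ) 𝔱 ξ, a ν = 1 →
      ∑ᶠ ν ∈ weightsAt (infinitesimal ρ) 𝔱 ξ, a ν • ν = ξ →
      (∀ ν ∈ weightsAt (infinitesimal ρ) 𝔱 ξ,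
        w ν ∈ weightSpace (infinitesimal ρ) 𝔱 ν ∧ ‖w ν‖ = 1) →
      ∃ hv : ∑ᶠ ν ∈ weightsAt (infinitesimal ρ) 𝔱 ξ, ((Real.sqrt (a ν) : ℝ) : ℂ) • w ν ≠ 0,
        Projectivization.mk ℂ
          (∑ᶠ ν ∈ weightsAt (infinitesimal ρ) 𝔱 ξ, ((Real.sqrt (a ν) : ℝ) : ℂ) • w ν) hv
          ∈ criticalSet (infinitesimal ρ) 𝔱 ξ := by
  have hrep : IsRepresentation (𝔨 := GroupLieAlgebra 𝓘(ℝ, E) K) (infinitesimal ρ) :=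
    infinitesimal_lie ρ hρ
  have hskew : IsSkew (𝔨 := GroupLieAlgebra 𝓘(ℝ, E) K) (infinitesimal ρ) :=
    inner_infinitesimal_left ρ hρ
  have hfin : (weightsAt (infinitesimal ρ) 𝔱 ξ).Finite :=
    (weights_finite hskew).subset fun ν hν => hν.1
  have hrd : RootDistinct 𝔱 (weightsAt (infinitesimal ρ) 𝔱 ξ) := hreg.rootDistinct_weightsAt
  obtain ⟨S, hS⟩ := hfin.exists_finset_coe
  have hmem (ν : Module.Dual ℝ 𝔱) : ν ∈ weightsAt (infinitesimal ρ) 𝔱 ξ ↔ ν ∈ S := by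
    rw [← hS, Finset.mem_coe]
  -- Finiteness of `Λ_ξ` turns every `∑ᶠ` into an honest sum over `S`.
  simp only [hmem, finsum_mem_finset_eq_sum]
  obtain ⟨a, ha, ha1, haξ⟩ := exists_convex_combination hξ hS
  obtain ⟨w, hw⟩ := exists_unit_weight_vectors (weightsAt (infinitesimal ρ) 𝔱 ξ) fun ν hν => hν.1
  simp only [hmem] at hw
  obtain ⟨_, hcrit⟩ := mk_sum_mem_criticalSet hS hrd hrep hskew ha ha1 haξ hw
  exact ⟨⟨_, hcrit⟩, hrd, hfin, ⟨a, ha, ha1, haξ⟩, fun a w ha ha1 haξ hw =>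
    mk_sum_mem_criticalSet hS hrd hrep hskew ha ha1 haξ hw⟩
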